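/- For a nonnegative integer $k$ and $\zeta\in\mathbb C$ let $E_k(\zeta)=\sum_{j=0}^{k}\frac{\zeta^j}{j!}$, and let \[ \mathrm{erf}(z)=\frac1{\sqrt{2\pi}}\int_{-\infty}^{z}e^{-t^2/2}\,dt\qquad(z\in\mathbb C), \] where the integral is taken along the horizontal ray from $-\infty$ to $z$ (so that $\mathrm{erf}$ is the entire extension of the standard Gaussian distribution function). Fix $\varepsilon>0$. Then \[ \frac{E_{n-1}\bigl(m(1+m^{-1/2}\xi)(1+m^{-1/2}\bar\eta)\bigr)}{e^{m+\sqrt m(\xi+\bar\eta)}} =e^{\xi\bar\eta}\,\mathrm{erf}(-\xi-\bar\eta)+O\bigl(m^{-\frac12+\varepsilon}\bigr) \] as $m,n\to+\infty$ with $n=m+O(1)$ ($m$ a positive real, $n$ a positive integer), uniformly for $\xi,\eta$ in compact subsets of $\mathbb C$. That is: for every $\varepsilon>0$, every real $A$ and every compact $K\subset\mathbb C$ there are constants $C,M>0$, depending only on $\varepsilon$, $A$ and $K$, such that for all real $m\ge M$, all integers $n\ge1$ with $|n-m|\le A$ and all $\xi,\eta\in K$, the absolute value of the difference between the left-hand side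 and $e^{\xi\bar\eta}\,\mathrm{erf}(-\xi-\bar\eta)$ is at most $C\,m^{-\frac12+\varepsilon}$. -/

import Mathlib

/-- The partial sum `E_k(ζ) = ∑_{j=0}^k ζ^j / j!` of the Taylor series of the exponential. -/
noncomputable def expPartialSum (k : ℕ) (ζ : ℂ) : ℂ :=
  ∑ j ∈ Finset.range (k + 1), ζ ^ j / (j.factorial : ℂ)

/-- The probabilistic error function `erf z = (2π)^{-1/2} ∫_{-∞}^z e^{-t²/2} dt` for complex `z`.
The path of integration is the horizontal ray from `-∞` to `z`, parametrised as `z + t`, `t ≤ 0`;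
the integral converges absolutely and gives the entire extension of the Gaussian distribution
function. -/
noncomputable def gaussErf (z : ℂ) : ℂ :=
  ((Real.sqrt (2 * Real.pi))⁻¹ : ℝ) * ∫ t in Set.Iic (0 : ℝ), Complex.exp (-(z + (t : ℂ)) ^ 2 / 2)

/-- For real argument, `gaussErf` is the standard Gaussian distribution function. -/
theorem gaussErf_ofReal (x : ℝ) :
    gaussErf (x : ℂ) =
      (((Real.sqrt (2 * Real.pi))⁻¹ * ∫ t in Set.Iic x, Real.exp (-t ^ 2 / 2) : ℝ) : ℂ) := by
  have h := (MeasureTheory.measurePreserving_add_left MeasureTheory.volume x).setIntegral_preimage_emb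
    (measurableEmbedding_addLeft x) (fun t : ℝ => Real.exp (-t ^ 2 / 2)) (Set.Iic x)
  have hs : (fun y : ℝ => x + y) ⁻¹' Set.Iic x = Set.Iic 0 := by
    ext y; simp
  rw [hs] at h
  rw [← h, gaussErf, Complex.ofReal_mul, ← integral_complex_ofReal]
  push_cast
  rfl

/-! Put `N = n - 1`, and write `θ` for the conjugate of `η`. The argument of the partial sum is `m +
√m (ξ + θ) + ξ θ = N + √N v` with `v = ξ + θ + O(N ^ (-1/2))`, and the product term `ξ θ` accounts
for the factor `e^{ξθ}`. It remains to compare `E_N(N + √N v) e^{-(N + √N v)}` with `erf(-v)` on a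
disc (`exists_norm_expPartialSum_rescaled_sub_gaussErf_le`).

Differentiation in `v` collapses the sum to one term, `-stirlingFactor N * (1 + v/√N)^N e^{-√N v}`.
By Stirling's formula and a second-order expansion of the logarithm, this differs by `O(N ^ (-1/2))`
from `-(2π)^{-1/2} e^{-v²/2}`, the derivative of `erf(-v)`. The mean value inequality then leaves
only `v = 0`, where `E_N(N) e^{-N} = 1/2 + O(N ^ (-1/2))` follows from Laplace's method for a real
integral (`exists_norm_expPartialSum_natCast_sub_half_le`). -/

open Filter Topology MeasureTheory

/-! ### Derivative of the normalised partial sum -/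

/-- The exponential partial sum satisfies `E_k' = E_k - z ^ k / k!`. -/
theorem hasDerivAt_expPartialSum (k : ℕ) (z : ℂ) :
    HasDerivAt (expPartialSum k) (expPartialSum k z - z ^ k / (k.factorial : ℂ)) z := by
  induction k with
  | zero =>
    have : expPartialSum 0 = fun _ => 1 := by ext w; simp [expPartialSum]
    rw [this]
    simpa using hasDerivAt_const z (1 : ℂ)
  | succ k ih =>
    have h : expPartialSum (k + 1) =
        fun w => expPartialSum k w + w ^ (k + 1) / ((k + 1).factorial : ℂ) := by
      ext w
      rw [expPartialSum, Finset.sum_range_succ, expPartialSum]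
    rw [h]
    refine (ih.add ((hasDerivAt_pow (k + 1) z).div_const _)).congr_deriv ?_
    have h1 : ((k : ℂ) + 1) ≠ 0 := Nat.cast_add_one_ne_zero k
    have h2 : (k.factorial : ℂ) ≠ 0 := by exact_mod_cast k.factorial_ne_zero
    rw [Nat.factorial_succ]
    push_cast
    field_simp
    ring

theorem expPartialSum_zero_right (k : ℕ) : expPartialSum k 0 = 1 := by
  rw [expPartialSum, Finset.sum_range_succ']
  simp

/-- The normalised partial sum `E_k(z) e^{-z}` has derivative `-z ^ k e^{-z} / k!`. -/
theorem hasDerivAt_expPartialSum_mul_exp_neg (k : ℕ) (z : ℂ) :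
    HasDerivAt (fun z => expPartialSum k z * Complex.exp (-z))
      (-(z ^ k / (k.factorial : ℂ) * Complex.exp (-z))) z := by
  refine ((hasDerivAt_expPartialSum k z).mul (hasDerivAt_neg z).cexp).congr_deriv ?_
  ring

/-! ### Rescaling at the edge, and Stirling's formula with a rate -/

/-- The reciprocal of the ratio of `N!` to its Stirling approximation, up to `√(2π)`. -/
noncomputable def stirlingFactor (N : ℕ) : ℝ :=
  √N * (N : ℝ) ^ N * Real.exp (-N) / N.factorial

theorem hasDerivAt_expPartialSum_rescaled {N : ℕ} (hN : N ≠ 0) (v : ℂ) :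
    HasDerivAt (fun v : ℂ => expPartialSum N (N + (√N : ℝ) * v) *
        Complex.exp (-(N + (√N : ℝ) * v)))
      (-((stirlingFactor N : ℂ) * ((1 + v / (√N : ℝ)) ^ N * Complex.exp (-((√N : ℝ) * v))))) v := by
  have h0 : HasDerivAt (fun v : ℂ => (N : ℂ) + (√N : ℝ) * v) ((√N : ℝ) : ℂ) v := by
    simpa using ((hasDerivAt_id v).const_mul ((√N : ℝ) : ℂ)).const_add (N : ℂ)
  refine ((hasDerivAt_expPartialSum_mul_exp_neg N _).comp v h0).congr_deriv ?_
  have hs : ((√N : ℝ) : ℂ) ≠ 0 := by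
    rw [Complex.ofReal_ne_zero, Real.sqrt_ne_zero (Nat.cast_nonneg N)]
    exact_mod_cast hN
  have hsq : ((√N : ℝ) : ℂ) * ((√N : ℝ) : ℂ) = N := by
    rw [← Complex.ofReal_mul, Real.mul_self_sqrt (Nat.cast_nonneg N), Complex.ofReal_natCast]
  have h1 : (N : ℂ) + (√N : ℝ) * v = N * (1 + v / (√N : ℝ)) := by
    have h : ((√N : ℝ) : ℂ) * (v / (√N : ℝ)) = v := by field_simp
    linear_combination (v / (√N : ℝ)) * hsq - ((√N : ℝ) : ℂ) * h
  have h2 : Complex.exp (-(N + (√N : ℝ) * v)) =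
      Complex.exp (-N) * Complex.exp (-((√N : ℝ) * v)) := by
    rw [← Complex.exp_add]; ring_nf
  rw [h2, h1, mul_pow, stirlingFactor]
  push_cast
  ring

theorem stirlingFactor_eq (N : ℕ) : stirlingFactor N = (√2 * Stirling.stirlingSeq N)⁻¹ := by
  rw [stirlingFactor, Stirling.stirlingSeq, div_pow, ← Real.exp_nat_mul, mul_one, Real.exp_neg,
    Real.sqrt_mul (by norm_num : (0 : ℝ) ≤ 2)]
  have : √2 * √2 = (2:ℝ) := Real.mul_self_sqrt (by norm_num)
  have h2 : √2 ≠ (0 : ℝ) := by positivity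
  have h3 : (N.factorial : ℝ) ≠ 0 := by exact_mod_cast N.factorial_ne_zero
  field_simp

/-- The one-step bounds `1 / (12 k (k + 1))` telescope; then the upper index tends to infinity. -/
theorem log_stirlingSeq_sub_log_sqrt_pi_le {N : ℕ} (hN : N ≠ 0) :
    Real.log (Stirling.stirlingSeq N) - Real.log √Real.pi ≤ 1 / (12 * N) := by
  have hstep : ∀ k : ℕ, Real.log (Stirling.stirlingSeq N) -
      Real.log (Stirling.stirlingSeq (N + k)) ≤ 1 / (12 * N) - 1 / (12 * (N + k : ℕ)) := by
    intro k
    induction k with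
    | zero => simp
    | succ k ih =>
      have h := Stirling.log_stirlingSeq_sdiff_le (N + k)
      have e : (1 : ℝ) / (12 * (N + k : ℕ) * ((N + k : ℕ) + 1)) =
          1 / (12 * (N + k : ℕ)) - 1 / (12 * (N + (k + 1) : ℕ)) := by
        have : (N : ℝ) + k ≠ 0 := by
          have : (0 : ℝ) < N := by exact_mod_cast Nat.pos_of_ne_zero hN
          positivity
        have : (N : ℝ) + k + 1 ≠ 0 := by positivity
        have : (N : ℝ) + (k + 1) ≠ 0 := by positivity
        push_cast
        field_simp
        ring
      rw [e] at h
      rw [← add_assoc] at h ⊢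
      linarith
  have hlim : Tendsto (fun k : ℕ => Real.log (Stirling.stirlingSeq N) -
      Real.log (Stirling.stirlingSeq (N + k))) atTop
      (𝓝 (Real.log (Stirling.stirlingSeq N) - Real.log √Real.pi)) := by
    refine tendsto_const_nhds.sub (Tendsto.log ?_ (by positivity))
    have := Stirling.tendsto_stirlingSeq_sqrt_pi.comp (tendsto_add_atTop_nat N)
    refine this.congr fun k => ?_
    simp [add_comm]
  refine le_of_tendsto' hlim fun k => (hstep k).trans ?_
  have : (0 : ℝ) ≤ 1 / (12 * (N + k : ℕ)) := by positivity
  linarith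

/-- The proof gives an error `O(1/N)`; it is weakened to the order of the other error terms. -/
theorem abs_stirlingFactor_sub_le {N : ℕ} (hN : N ≠ 0) :
    |stirlingFactor N - (√(2 * Real.pi))⁻¹| ≤ 1 / √N := by
  have h1 := Stirling.sqrt_pi_le_stirlingSeq hN
  have h2 := log_stirlingSeq_sub_log_sqrt_pi_le hN
  have hp : 0 < √Real.pi := by positivity
  have hs : 0 < Stirling.stirlingSeq N := hp.trans_le h1
  have hN1 : (1 : ℝ) ≤ N := by exact_mod_cast Nat.one_le_iff_ne_zero.mpr hN
  set a := (√(2 * Real.pi))⁻¹ with ha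
  have ha0 : 0 < a := by positivity
  have ha1 : a ≤ 1 := by
    apply inv_le_one_of_one_le₀
    rw [Real.one_le_sqrt]
    nlinarith [Real.pi_gt_three]
  have hle : stirlingFactor N ≤ a := by
    rw [stirlingFactor_eq, ha, Real.sqrt_mul (by norm_num : (0 : ℝ) ≤ 2)]
    gcongr
  have hge : a * (1 - 1 / (12 * N)) ≤ stirlingFactor N := by
    have e : stirlingFactor N =
        a * Real.exp (-(Real.log (Stirling.stirlingSeq N) - Real.log √Real.pi)) := by
      rw [neg_sub, Real.exp_sub, Real.exp_log hp, Real.exp_log hs, stirlingFactor_eq, ha,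
        Real.sqrt_mul (by norm_num : (0 : ℝ) ≤ 2)]
      field_simp
    rw [e]
    gcongr
    have := Real.add_one_le_exp (-(Real.log (Stirling.stirlingSeq N) - Real.log √Real.pi))
    linarith
  have hb : a * (1 / (12 * N)) ≤ 1 / √N := by
    have h3 : √(N : ℝ) ≤ N := by
      rw [Real.sqrt_le_left (by positivity)]
      nlinarith
    have h4 : 0 < √(N : ℝ) := by positivity
    calc a * (1 / (12 * N)) ≤ 1 * (1 / (12 * N)) := by gcongr
      _ ≤ 1 / √N := by
        rw [one_mul]
        apply one_div_le_one_div_of_le h4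
        linarith
  rw [abs_le]
  constructor
  · linarith
  · have : 0 ≤ 1 / √(N : ℝ) := by positivity
    linarith

theorem abs_stirlingFactor_le_one {N : ℕ} (hN : N ≠ 0) : |stirlingFactor N| ≤ 1 := by
  have h1 := Stirling.sqrt_pi_le_stirlingSeq hN
  have h2 : (1 : ℝ) ≤ √2 := by rw [Real.one_le_sqrt]; norm_num
  have h3 : (1 : ℝ) ≤ √Real.pi := by rw [Real.one_le_sqrt]; linarith [Real.pi_gt_three]
  rw [stirlingFactor_eq, abs_of_nonneg (inv_nonneg.mpr (by nlinarith))]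
  exact inv_le_one_of_one_le₀ (by nlinarith)

/-! ### Gaussian approximation of the integrand -/

theorem norm_exp_neg_sq_div_two_le {R : ℝ} {v : ℂ} (hv : ‖v‖ ≤ R) :
    ‖Complex.exp (-v ^ 2 / 2)‖ ≤ Real.exp (R ^ 2) := by
  refine (Complex.norm_exp_le_exp_norm _).trans (Real.exp_le_exp.mpr ?_)
  rw [norm_div, norm_neg, norm_pow]
  have : ‖v‖ ^ 2 ≤ R ^ 2 := by gcongr
  have h0 : 0 ≤ R ^ 2 := by positivity
  norm_num
  linarith

/-- Gaussian approximation of `((1 + x) e^{-x}) ^ N` for complex `x` of size `N ^ (-1/2)`. -/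
theorem norm_one_add_pow_mul_exp_sub_le {R : ℝ} (hR : 0 ≤ R) {N : ℕ}
    (hN : 2 * R + R ^ 3 ≤ √N) (hN0 : N ≠ 0) {v : ℂ} (hv : ‖v‖ ≤ R) :
    ‖(1 + v / (√N : ℝ)) ^ N * Complex.exp (-((√N : ℝ) * v)) - Complex.exp (-v ^ 2 / 2)‖ ≤
      2 * R ^ 3 * Real.exp (R ^ 2) / √N := by
  have hs : 0 < √(N : ℝ) := Real.sqrt_pos.mpr (by exact_mod_cast Nat.pos_of_ne_zero hN0)
  have hsc : ((√N : ℝ) : ℂ) ≠ 0 := by exact_mod_cast hs.ne'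
  have hsq : √(N : ℝ) * √N = N := Real.mul_self_sqrt (Nat.cast_nonneg N)
  have hsqc : ((√N : ℝ) : ℂ) * ((√N : ℝ) : ℂ) = N := by
    rw [← Complex.ofReal_mul, hsq, Complex.ofReal_natCast]
  set x : ℂ := v / (√N : ℝ) with hx
  have hxn : ‖x‖ ≤ R / √N := by
    rw [hx, norm_div, Complex.norm_of_nonneg hs.le]; gcongr
  have hxh : ‖x‖ ≤ 1 / 2 := by
    refine hxn.trans ?_
    rw [div_le_iff₀ hs]
    have : 0 ≤ R ^ 3 := by positivity
    linarith
  have hlog := Complex.norm_log_sub_logTaylor_le 2 (hxh.trans_lt (by norm_num))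
  have hT : Complex.logTaylor (2 + 1) x = x - x ^ 2 / 2 := by
    simp [Complex.logTaylor_succ, Complex.logTaylor_zero]
    ring
  rw [hT] at hlog
  -- `δ` is the cubic remainder of the exponent. In `hN`, the term `2 * R` gives `‖x‖ ≤ 1/2`, and `R
  -- ^ 3` gives `‖δ‖ ≤ 1`, so that `‖e^δ - 1‖ ≤ 2‖δ‖`.
  set δ : ℂ := N * (Complex.log (1 + x) - (x - x ^ 2 / 2)) with hδ
  have hδn : ‖δ‖ ≤ R ^ 3 / √N := by
    have hi : (1 - ‖x‖)⁻¹ ≤ 2 := by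
      rw [inv_le_comm₀ (by linarith) (by norm_num)]
      linarith
    calc ‖δ‖ = N * ‖Complex.log (1 + x) - (x - x ^ 2 / 2)‖ := by simp [hδ]
      _ ≤ N * (‖x‖ ^ (2 + 1) * (1 - ‖x‖)⁻¹ / ((2 : ℕ) + 1)) := by gcongr
      _ ≤ N * ((R / √N) ^ (2 + 1) * 2 / ((2 : ℕ) + 1)) := by
        have : 0 ≤ (1 - ‖x‖)⁻¹ := inv_nonneg.mpr (by linarith)
        gcongr
      _ = (2 / 3) * (R ^ 3 / √N) := by
        rw [← hsq]; push_cast; field_simp; norm_num; ring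
      _ ≤ R ^ 3 / √N := by
        have : 0 ≤ R ^ 3 / √N := by positivity
        linarith
  have hδ1 : ‖δ‖ ≤ 1 := by
    refine hδn.trans ?_
    rw [div_le_one hs]
    linarith
  have h1x : 1 + x ≠ 0 := by
    intro h
    have : x = -1 := by linear_combination h
    rw [this] at hxh
    norm_num at hxh
  have e : (1 + x) ^ N * Complex.exp (-((√N : ℝ) * v)) =
      Complex.exp (-v ^ 2 / 2) * Complex.exp δ := by
    have hv' : v = (√N : ℝ) * x := by rw [hx]; field_simp
    nth_rw 1 [← Complex.exp_log h1x]
    rw [← Complex.exp_nat_mul, ← Complex.exp_add, ← Complex.exp_add, hδ, hv']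
    congr 1
    rw [← hsqc]
    ring
  rw [e]
  have : Complex.exp (-v ^ 2 / 2) * Complex.exp δ - Complex.exp (-v ^ 2 / 2) =
      Complex.exp (-v ^ 2 / 2) * (Complex.exp δ - 1) := by ring
  rw [this, norm_mul]
  have h3 := norm_exp_neg_sq_div_two_le hv
  calc _ ≤ Real.exp (R ^ 2) * (2 * ‖δ‖) :=
        mul_le_mul h3 (Complex.norm_exp_sub_one_le hδ1) (norm_nonneg _) (Real.exp_pos _).le
    _ ≤ Real.exp (R ^ 2) * (2 * (R ^ 3 / √N)) := by gcongr
    _ = _ := by ring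

/-- Gaussian approximation of `((1 - x) e^x) ^ N`, uniform on `[0, 1]`. -/
theorem abs_one_sub_mul_exp_pow_sub_le {N : ℕ} (hN : N ≠ 0) {x : ℝ} (h0 : 0 ≤ x) (h1 : x ≤ 1) :
    |((1 - x) * Real.exp x) ^ N - Real.exp (-(N * x ^ 2) / 2)| ≤
      8 * (N * x ^ 3) * Real.exp (-(N * x ^ 2) / 2) := by
  have hN1 : (1 : ℝ) ≤ N := by exact_mod_cast Nat.one_le_iff_ne_zero.mpr hN
  have hgp := Real.exp_pos (-(N * x ^ 2) / 2)
  have hpow : Real.exp (-x ^ 2 / 2) ^ N = Real.exp (-(N * x ^ 2) / 2) := by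
    rw [← Real.exp_nat_mul]; ring_nf
  have hnn : 0 ≤ (1 - x) * Real.exp x := mul_nonneg (by linarith) (Real.exp_pos x).le
  -- Two terms of the positive series of `-log (1 - x)` give `-log (1 - x) ≥ x + x² / 2`.
  have hup : (1 - x) * Real.exp x ≤ Real.exp (-x ^ 2 / 2) := by
    rcases h1.eq_or_lt with rfl | hlt
    · simp [(Real.exp_pos _).le]
    · have hs := Real.hasSum_pow_div_log_of_abs_lt_one (x := x) (by rwa [abs_of_nonneg h0])
      have := sum_le_hasSum (Finset.range 2) (fun i _ => by positivity) hs
      norm_num [Finset.sum_range_succ] at this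
      rw [← Real.exp_log (by linarith : 0 < 1 - x), ← Real.exp_add, Real.exp_le_exp]
      linarith
  have hupN : ((1 - x) * Real.exp x) ^ N ≤ Real.exp (-(N * x ^ 2) / 2) := by
    rw [← hpow]; gcongr
  rw [abs_sub_comm, abs_of_nonneg (by linarith)]
  rcases le_or_gt x (1 / 2) with hx | hx
  · have hl := Real.abs_log_sub_add_sum_range_le (x := x) (by rw [abs_of_nonneg h0]; linarith) 2
    norm_num [Finset.sum_range_succ, abs_of_nonneg h0] at hl
    have hq : x ^ 3 / (1 - x) ≤ 2 * x ^ 3 := by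
      rw [div_le_iff₀ (by linarith)]
      nlinarith [pow_nonneg h0 3]
    have hlow : Real.exp (-x ^ 2 / 2) * Real.exp (-(2 * x ^ 3)) ≤ (1 - x) * Real.exp x := by
      rw [← Real.exp_log (by linarith : 0 < 1 - x), ← Real.exp_add, ← Real.exp_add,
        Real.exp_le_exp]
      have := (abs_le.mp hl).1
      linarith
    have hlowN : Real.exp (-(N * x ^ 2) / 2) * Real.exp (-(2 * (N * x ^ 3))) ≤
        ((1 - x) * Real.exp x) ^ N := by
      calc _ = (Real.exp (-x ^ 2 / 2) * Real.exp (-(2 * x ^ 3))) ^ N := by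
            rw [mul_pow, hpow, ← Real.exp_nat_mul]; ring_nf
        _ ≤ _ := by gcongr
    have hexp := Real.add_one_le_exp (-(2 * (N * x ^ 3)))
    have hp : 0 ≤ N * x ^ 3 := by positivity
    nlinarith [mul_le_mul_of_nonneg_left hexp hgp.le, mul_nonneg hp hgp.le]
  -- Beyond `1/2` the bound is trivial: this is where the constant `8 = 2 ^ 3` comes from.
  · have h8 : 1 ≤ 8 * (N * x ^ 3) := by
      have : (1 / 2 : ℝ) ^ 3 ≤ x ^ 3 := by gcongr
      nlinarith
    have := pow_nonneg hnn N
    nlinarith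

/-! ### The complex Gaussian distribution function -/

/-- From `(x + t)² ≥ t²/2 - x²` with `x = Re z`. The bound is uniform in `z`, so it can serve as a
dominating function. -/
theorem norm_exp_neg_add_ofReal_sq_le {B : ℝ} {z : ℂ} (hz : ‖z‖ ≤ B) (t : ℝ) :
    ‖Complex.exp (-(z + t) ^ 2 / 2)‖ ≤ Real.exp (B ^ 2) * Real.exp (-(1 / 4) * t ^ 2) := by
  rw [Complex.norm_exp, ← Real.exp_add, Real.exp_le_exp]
  have h1 : (-(z + t) ^ 2 / 2).re = (z.im ^ 2 - (z.re + t) ^ 2) / 2 := by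
    rw [Complex.div_ofNat_re]
    simp [pow_two]
  have h2 : z.re ^ 2 + z.im ^ 2 ≤ B ^ 2 := by
    have := Complex.sq_norm z
    rw [Complex.normSq_apply] at this
    have h3 : ‖z‖ ^ 2 ≤ B ^ 2 := by gcongr
    nlinarith
  rw [h1]
  nlinarith [sq_nonneg (2 * z.re + t), sq_nonneg z.re]

theorem integrable_exp_neg_add_ofReal_sq (z : ℂ) :
    Integrable (fun t : ℝ => Complex.exp (-(z + t) ^ 2 / 2)) :=
  ((integrable_exp_neg_mul_sq (by norm_num : (0 : ℝ) < 1 / 4)).const_mul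
    (Real.exp (‖z‖ ^ 2))).mono' (by fun_prop)
    (Eventually.of_forall (norm_exp_neg_add_ofReal_sq_le le_rfl))

theorem tendsto_exp_neg_add_ofReal_sq_atBot (z : ℂ) :
    Tendsto (fun t : ℝ => Complex.exp (-(z + t) ^ 2 / 2)) atBot (𝓝 0) := by
  refine squeeze_zero_norm (norm_exp_neg_add_ofReal_sq_le le_rfl) ?_
  rw [← mul_zero (Real.exp (‖z‖ ^ 2))]
  refine tendsto_const_nhds.mul (Real.tendsto_exp_atBot.comp ?_)
  have h : Tendsto (fun t : ℝ => t ^ 2) atBot atTop :=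
    ((tendsto_pow_atTop two_ne_zero).comp tendsto_abs_atBot_atTop).congr fun t => sq_abs t
  exact h.const_mul_atTop_of_neg (by norm_num)

/-- The complex Gaussian distribution function has derivative the Gaussian density. -/
theorem hasDerivAt_gaussErf (z : ℂ) :
    HasDerivAt gaussErf (((√(2 * Real.pi))⁻¹ : ℝ) * Complex.exp (-z ^ 2 / 2)) z := by
  have hd : ∀ (w : ℂ) (t : ℝ), HasDerivAt (fun w : ℂ => Complex.exp (-(w + t) ^ 2 / 2))
      (-(w + t) * Complex.exp (-(w + t) ^ 2 / 2)) w := by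
    intro w t
    refine (((((hasDerivAt_id w).add_const (t : ℂ)).pow 2).neg.div_const 2).cexp).congr_deriv ?_
    simp
    ring
  have hdt : ∀ (t : ℝ), HasDerivAt (fun t : ℝ => Complex.exp (-(z + t) ^ 2 / 2))
      (-(z + t) * Complex.exp (-(z + t) ^ 2 / 2)) t := by
    intro t
    have h := ((((((hasDerivAt_id (t : ℂ)).const_add z).pow 2).neg.div_const 2).cexp)).comp_ofReal
    refine h.congr_deriv ?_
    simp
    ring
  set B := ‖z‖ + 1 with hB
  have hB0 : 0 ≤ B := by positivity
  have hint : Integrable fun t : ℝ => (B + |t|) * (Real.exp (B ^ 2) * Real.exp (-(1 / 4) * t ^ 2)) := by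
    have h1 := (integrable_exp_neg_mul_sq (by norm_num : (0 : ℝ) < 1 / 4)).const_mul
      (B * Real.exp (B ^ 2))
    have h2 := ((integrable_mul_exp_neg_mul_sq (by norm_num : (0 : ℝ) < 1 / 4)).norm).const_mul
      (Real.exp (B ^ 2))
    refine (h1.add h2).congr (Eventually.of_forall fun t => ?_)
    simp only [Pi.add_apply, Real.norm_eq_abs, abs_mul, Real.abs_exp]
    ring
  have hbound : ∀ (t : ℝ), ∀ w ∈ Metric.ball z 1, ‖-(w + t) * Complex.exp (-(w + t) ^ 2 / 2)‖ ≤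
      (B + |t|) * (Real.exp (B ^ 2) * Real.exp (-(1 / 4) * t ^ 2)) := by
    intro t w hw
    have hwB : ‖w‖ ≤ B := by
      have := norm_le_norm_add_norm_sub' w z
      rw [mem_ball_iff_norm] at hw
      linarith
    rw [norm_mul, norm_neg]
    refine mul_le_mul ?_ (norm_exp_neg_add_ofReal_sq_le hwB t) (norm_nonneg _) (by positivity)
    refine (norm_add_le _ _).trans ?_
    rw [Complex.norm_real, Real.norm_eq_abs]
    linarith
  have key := hasDerivAt_integral_of_dominated_loc_of_deriv_le
    (μ := volume.restrict (Set.Iic (0 : ℝ)))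
    (F := fun (w : ℂ) (t : ℝ) => Complex.exp (-(w + t) ^ 2 / 2))
    (F' := fun (w : ℂ) (t : ℝ) => -(w + t) * Complex.exp (-(w + t) ^ 2 / 2))
    (Metric.ball_mem_nhds z one_pos)
    (Eventually.of_forall fun w => by fun_prop)
    (integrable_exp_neg_add_ofReal_sq z).integrableOn
    (by fun_prop)
    (Eventually.of_forall hbound)
    hint.integrableOn
    (Eventually.of_forall fun t w _ => hd w t)
  -- The integrand depends only on `z + t`, so its `z`-derivative is also its `t`-derivative and
  -- integrates exactly.
  have hFTC := integral_Iic_of_hasDerivAt_of_tendsto' (a := (0 : ℝ)) (fun t _ => hdt t)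
    key.1 (tendsto_exp_neg_add_ofReal_sq_atBot z)
  have h2 := key.2
  rw [hFTC] at h2
  refine (h2.const_mul _).congr_deriv ?_
  simp

theorem gaussErf_zero : gaussErf 0 = 1 / 2 := by
  have h := gaussErf_ofReal 0
  have h2 : ∫ t in Set.Iic (0 : ℝ), Real.exp (-t ^ 2 / 2) = √(2 * Real.pi) / 2 := by
    have h3 := integral_gaussian_Ioi (1 / 2)
    have h4 := integral_comp_neg_Iic (0 : ℝ) fun t => Real.exp (-(1 / 2) * t ^ 2)
    rw [neg_zero, h3] at h4
    rw [show 2 * Real.pi = Real.pi / (1 / 2) by ring, ← h4]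
    congr 1 with t
    ring_nf
  rw [h2] at h
  rw [Complex.ofReal_zero] at h
  rw [h]
  have : √(2 * Real.pi) ≠ 0 := by positivity
  have h5 : (√(2 * Real.pi))⁻¹ * (√(2 * Real.pi) / 2) = 1 / 2 := by field_simp
  rw [h5]
  norm_num

/-! ### The value at the centre of the edge -/

/-- Laplace's method for the incomplete Gamma integral, with error term. -/
theorem exists_abs_integral_one_sub_pow_mul_exp_sub_le :
    ∃ C : ℝ, 0 ≤ C ∧ ∀ N : ℕ, N ≠ 0 →
      |(∫ s in (0 : ℝ)..√N, (1 - s / √N) ^ N * Real.exp (√N * s)) - √(2 * Real.pi) / 2| ≤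
        C / √N := by
  have hg : ∫ s in Set.Ioi (0 : ℝ), Real.exp (-s ^ 2 / 2) = √(2 * Real.pi) / 2 := by
    have h3 := integral_gaussian_Ioi (1 / 2)
    rw [show 2 * Real.pi = Real.pi / (1 / 2) by ring, ← h3]
    congr 1 with t
    ring_nf
  have hgi : Integrable (fun s : ℝ => Real.exp (-s ^ 2 / 2)) := by
    refine (integrable_exp_neg_mul_sq (by norm_num : (0 : ℝ) < 1 / 2)).congr
      (Eventually.of_forall fun s => ?_)
    simp only
    ring_nf
  have hdi : Integrable (fun s : ℝ => 8 * s ^ 3 * Real.exp (-s ^ 2 / 2)) := by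
    refine ((integrable_rpow_mul_exp_neg_mul_sq (by norm_num : (0 : ℝ) < 1 / 2)
      (by norm_num : (-1 : ℝ) < (3 : ℕ))).const_mul 8).congr (Eventually.of_forall fun s => ?_)
    simp only [Real.rpow_natCast]
    ring_nf
  refine ⟨∫ s in Set.Ioi (0 : ℝ), 8 * s ^ 3 * Real.exp (-s ^ 2 / 2),
    setIntegral_nonneg measurableSet_Ioi fun s hs => ?_, fun N hN => ?_⟩
  · have : (0 : ℝ) < s := hs
    positivity
  have hN1 : (1 : ℝ) ≤ N := by exact_mod_cast Nat.one_le_iff_ne_zero.mpr hN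
  set r := √(N : ℝ) with hr
  have hr0 : 0 < r := by positivity
  have hr2 : r * r = N := Real.mul_self_sqrt (Nat.cast_nonneg N)
  set f : ℝ → ℝ := fun s => (1 - s / r) ^ N * Real.exp (r * s) with hf
  have hfc : Continuous f := by fun_prop
  have hfi : Integrable ((Set.Ioc 0 r).indicator f) :=
    (integrable_indicator_iff measurableSet_Ioc).mpr
      ((hfc.integrableOn_Icc).mono_set Set.Ioc_subset_Icc_self)
  have e1 : ∫ s in (0 : ℝ)..r, f s = ∫ s in Set.Ioi (0 : ℝ), (Set.Ioc 0 r).indicator f s := by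
    rw [intervalIntegral.integral_of_le hr0.le, setIntegral_indicator measurableSet_Ioc,
      Set.inter_eq_right.mpr Set.Ioc_subset_Ioi_self]
  rw [e1, ← hg, ← integral_sub hfi.integrableOn hgi.integrableOn, ← integral_div,
    ← Real.norm_eq_abs]
  refine norm_integral_le_of_norm_le (hdi.div_const r).integrableOn ?_
  refine (ae_restrict_iff' measurableSet_Ioi).mpr (Eventually.of_forall fun s hs => ?_)
  have hs0 : 0 < s := hs
  have hx2 : (N : ℝ) * (s / r) ^ 2 = s ^ 2 := by rw [← hr2]; field_simp
  have hx3 : (N : ℝ) * (s / r) ^ 3 = s ^ 3 / r := by rw [← hr2]; field_simp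
  rw [Real.norm_eq_abs]
  by_cases hsr : s ≤ r
  · rw [Set.indicator_of_mem (Set.mem_Ioc.mpr ⟨hs0, hsr⟩)]
    have h := abs_one_sub_mul_exp_pow_sub_le hN (x := s / r) (by positivity)
      ((div_le_one hr0).mpr hsr)
    have e2 : ((1 - s / r) * Real.exp (s / r)) ^ N = f s := by
      rw [mul_pow, ← Real.exp_nat_mul, hf, ← hr2]
      congr 2
      field_simp
    rw [e2, hx2, hx3] at h
    refine h.trans_eq ?_
    ring
  · rw [Set.indicator_of_notMem (fun h => hsr h.2), zero_sub, abs_neg, Real.abs_exp]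
    -- Past the cut-off only the Gaussian tail remains, and `s ^ 3 / r ≥ 1` puts it under the same
    -- majorant.
    have h1 : 1 ≤ s ^ 3 / r := by
      rw [le_div_iff₀ hr0, one_mul]
      have hr1 : 1 ≤ r := Real.one_le_sqrt.mpr hN1
      have : s ≤ s ^ 3 := le_self_pow₀ (by linarith) (by norm_num)
      linarith
    have h2 := Real.exp_pos (-s ^ 2 / 2)
    have : 8 * s ^ 3 * Real.exp (-s ^ 2 / 2) / r = 8 * (s ^ 3 / r) * Real.exp (-s ^ 2 / 2) := by
      ring
    rw [this]
    nlinarith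

/-- `E_N(N) e^{-N}` tends to `1 / 2` with error `O(N ^ (-1/2))`. -/
theorem exists_norm_expPartialSum_natCast_sub_half_le :
    ∃ C : ℝ, 0 ≤ C ∧ ∀ N : ℕ, N ≠ 0 →
      ‖expPartialSum N N * Complex.exp (-N) - 1 / 2‖ ≤ C / √N := by
  obtain ⟨C, hC, h⟩ := exists_abs_integral_one_sub_pow_mul_exp_sub_le
  refine ⟨C + √(2 * Real.pi) / 2, by positivity, fun N hN => ?_⟩
  have hN1 : (1 : ℝ) ≤ N := by exact_mod_cast Nat.one_le_iff_ne_zero.mpr hN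
  have hr0 : 0 < √(N : ℝ) := by positivity
  set J := ∫ s in (0 : ℝ)..√N, (1 - s / √N) ^ N * Real.exp (√N * s) with hJ
  -- Along `v = -s` the argument runs from `N` at `s = 0` down to `0` at `s = √N`, where the partial
  -- sum is `1`.
  have hFTC := intervalIntegral.integral_eq_sub_of_hasDerivAt (a := 0) (b := √(N : ℝ))
    (f := fun s : ℝ => expPartialSum N (N + (√N : ℝ) * (-(s : ℂ))) *
        Complex.exp (-(N + (√N : ℝ) * (-(s : ℂ)))))
    (f' := fun s : ℝ => (stirlingFactor N : ℂ) *
      (((1 - s / √N) ^ N * Real.exp (√N * s) : ℝ) : ℂ))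
    (fun s _ => by
      have h1 := (hasDerivAt_expPartialSum_rescaled hN (-(s : ℂ))).comp (s : ℂ)
        (hasDerivAt_neg (s : ℂ))
      refine h1.comp_ofReal.congr_deriv ?_
      push_cast
      ring_nf)
    (Continuous.intervalIntegrable (by fun_prop) _ _)
  have hsq : ((√N : ℝ) : ℂ) * ((√N : ℝ) : ℂ) = N := by
    rw [← Complex.ofReal_mul, Real.mul_self_sqrt (Nat.cast_nonneg N), Complex.ofReal_natCast]
  have hFTC' : (stirlingFactor N : ℂ) * (J : ℂ) =
      1 - expPartialSum N N * Complex.exp (-N) := by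
    rw [intervalIntegral.integral_const_mul, intervalIntegral.integral_ofReal] at hFTC
    rw [hFTC]
    simp [hsq, expPartialSum_zero_right]
  have e : expPartialSum N N * Complex.exp (-N) - 1 / 2 =
      ((-(stirlingFactor N * (J - √(2 * Real.pi) / 2) +
        (stirlingFactor N - (√(2 * Real.pi))⁻¹) * (√(2 * Real.pi) / 2)) : ℝ) : ℂ) := by
    have h2 : (√(2 * Real.pi))⁻¹ * (√(2 * Real.pi) / 2) = 1 / 2 := by
      have : √(2 * Real.pi) ≠ 0 := by positivity
      field_simp
    have h3 : -(stirlingFactor N * (J - √(2 * Real.pi) / 2) +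
        (stirlingFactor N - (√(2 * Real.pi))⁻¹) * (√(2 * Real.pi) / 2)) =
        1 / 2 - stirlingFactor N * J := by
      linear_combination h2
    rw [h3]
    push_cast
    linear_combination hFTC'
  rw [e, Complex.norm_real, Real.norm_eq_abs, abs_neg]
  calc _ ≤ |stirlingFactor N| * |J - √(2 * Real.pi) / 2| +
        |stirlingFactor N - (√(2 * Real.pi))⁻¹| * (√(2 * Real.pi) / 2) := by
        refine (abs_add_le _ _).trans (le_of_eq ?_)
        rw [abs_mul, abs_mul, abs_of_nonneg (by positivity : 0 ≤ √(2 * Real.pi) / 2)]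
    _ ≤ 1 * (C / √N) + 1 / √N * (√(2 * Real.pi) / 2) := by
        gcongr
        · exact abs_stirlingFactor_le_one hN
        · exact h N hN
        · exact abs_stirlingFactor_sub_le hN
    _ = _ := by ring

/-! ### Locally uniform asymptotics for integral parameter -/

theorem norm_gaussErf_sub_le {R : ℝ} {z w : ℂ} (hz : ‖z‖ ≤ R) (hw : ‖w‖ ≤ R) :
    ‖gaussErf w - gaussErf z‖ ≤ Real.exp (R ^ 2) * ‖w - z‖ := by
  refine (convex_closedBall (0 : ℂ) R).norm_image_sub_le_of_norm_hasDerivWithin_le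
    (fun x _ => (hasDerivAt_gaussErf x).hasDerivWithinAt) (fun x hx => ?_)
    (mem_closedBall_zero_iff.mpr hz) (mem_closedBall_zero_iff.mpr hw)
  have h1 : |(√(2 * Real.pi))⁻¹| ≤ 1 := by
    rw [abs_of_nonneg (by positivity)]
    apply inv_le_one_of_one_le₀
    rw [Real.one_le_sqrt]
    nlinarith [Real.pi_gt_three]
  rw [norm_mul, Complex.norm_real, Real.norm_eq_abs, ← one_mul (Real.exp (R ^ 2))]
  exact mul_le_mul h1 (norm_exp_neg_sq_div_two_le (mem_closedBall_zero_iff.mp hx))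
    (norm_nonneg _) zero_le_one

/-- The normalised partial sum at the edge, for integral parameter:
`E_N(N + √N v) e^{-(N + √N v)} = erf(-v) + O(N ^ (-1/2))` locally uniformly in `v`. -/
theorem exists_norm_expPartialSum_rescaled_sub_gaussErf_le {R : ℝ} (hR : 0 ≤ R) :
    ∃ C : ℝ, 0 ≤ C ∧ ∀ N : ℕ, N ≠ 0 → 2 * R + R ^ 3 ≤ √N → ∀ v : ℂ, ‖v‖ ≤ R →
      ‖expPartialSum N (N + (√N : ℝ) * v) * Complex.exp (-(N + (√N : ℝ) * v)) -
        gaussErf (-v)‖ ≤ C / √N := by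
  obtain ⟨C₀, hC₀, h0⟩ := exists_norm_expPartialSum_natCast_sub_half_le
  refine ⟨(2 * R ^ 3 * Real.exp (R ^ 2) + Real.exp (R ^ 2)) * R + C₀, by positivity,
    fun N hN hNR v hv => ?_⟩
  set H : ℂ → ℂ := fun v => expPartialSum N (N + (√N : ℝ) * v) *
    Complex.exp (-(N + (√N : ℝ) * v)) - gaussErf (-v) with hH
  have hderiv : ∀ w : ℂ, HasDerivAt H
      (-((stirlingFactor N : ℂ) * ((1 + w / (√N : ℝ)) ^ N * Complex.exp (-((√N : ℝ) * w)) -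
        Complex.exp (-w ^ 2 / 2)) +
        ((stirlingFactor N - (√(2 * Real.pi))⁻¹ : ℝ) : ℂ) * Complex.exp (-w ^ 2 / 2))) w := by
    intro w
    refine ((hasDerivAt_expPartialSum_rescaled hN w).sub
      ((hasDerivAt_gaussErf (-w)).comp w (hasDerivAt_neg w))).congr_deriv ?_
    push_cast
    rw [neg_sq]
    ring
  have hbound : ∀ w ∈ Metric.closedBall (0 : ℂ) R,
      ‖-((stirlingFactor N : ℂ) * ((1 + w / (√N : ℝ)) ^ N * Complex.exp (-((√N : ℝ) * w)) -
        Complex.exp (-w ^ 2 / 2)) +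
        ((stirlingFactor N - (√(2 * Real.pi))⁻¹ : ℝ) : ℂ) * Complex.exp (-w ^ 2 / 2))‖ ≤
      (2 * R ^ 3 * Real.exp (R ^ 2) + Real.exp (R ^ 2)) / √N := by
    intro w hw
    have hw' := mem_closedBall_zero_iff.mp hw
    rw [norm_neg]
    refine (norm_add_le _ _).trans ?_
    rw [norm_mul, norm_mul, Complex.norm_real, Complex.norm_real, Real.norm_eq_abs,
      Real.norm_eq_abs]
    calc _ ≤ 1 * (2 * R ^ 3 * Real.exp (R ^ 2) / √N) + 1 / √N * Real.exp (R ^ 2) := by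
          gcongr
          · exact abs_stirlingFactor_le_one hN
          · exact norm_one_add_pow_mul_exp_sub_le hR hNR hN hw'
          · exact abs_stirlingFactor_sub_le hN
          · exact norm_exp_neg_sq_div_two_le hw'
      _ = _ := by ring
  have hmv := (convex_closedBall (0 : ℂ) R).norm_image_sub_le_of_norm_hasDerivWithin_le
    (fun w _ => (hderiv w).hasDerivWithinAt) hbound
    (Metric.mem_closedBall_self hR) (mem_closedBall_zero_iff.mpr hv)
  have hH0 : ‖H 0‖ ≤ C₀ / √N := by
    simpa [hH, gaussErf_zero] using h0 N hN
  rw [sub_zero] at hmv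
  calc ‖H v‖ ≤ ‖H 0‖ + ‖H v - H 0‖ := norm_le_norm_add_norm_sub' _ _
    _ ≤ C₀ / √N + (2 * R ^ 3 * Real.exp (R ^ 2) + Real.exp (R ^ 2)) / √N * R := by
      gcongr
      exact hmv.trans (by gcongr)
    _ = _ := by ring

/-! ### From the integer `N` to the real parameter `m` -/

theorem abs_sqrt_sub_sqrt_le {a b : ℝ} (ha : 0 ≤ a) (hb : 1 ≤ b) : |√a - √b| ≤ |a - b| := by
  have h1 : 1 ≤ √b := Real.one_le_sqrt.mpr hb
  have h2 : a - b = (√a - √b) * (√a + √b) := by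
    linear_combination -Real.mul_self_sqrt ha + Real.mul_self_sqrt (by linarith : 0 ≤ b)
  rw [h2, abs_mul]
  have h3 : 1 ≤ |√a + √b| := by
    rw [abs_of_nonneg (by positivity)]
    linarith [Real.sqrt_nonneg a]
  exact le_mul_of_one_le_right (abs_nonneg _) h3

theorem mainTheorem9 (ε : ℝ) (hε : 0 < ε) (A : ℝ) (K : Set ℂ) (hK : IsCompact K) :
    ∃ C > (0 : ℝ), ∃ M > (0 : ℝ), ∀ (m : ℝ) (n : ℕ), M ≤ m → 1 ≤ n → |(n : ℝ) - m| ≤ A →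
      ∀ ξ ∈ K, ∀ η ∈ K,
        ‖expPartialSum (n - 1)
              ((m : ℂ) * (1 + ((m ^ (-(1 / 2) : ℝ) : ℝ) : ℂ) * ξ) *
                (1 + ((m ^ (-(1 / 2) : ℝ) : ℝ) : ℂ) * (starRingEnd ℂ) η)) /
            Complex.exp ((m : ℂ) + (Real.sqrt m : ℂ) * (ξ + (starRingEnd ℂ) η)) -
          Complex.exp (ξ * (starRingEnd ℂ) η) * gaussErf (-ξ - (starRingEnd ℂ) η)‖
        ≤ C * m ^ (-(1 / 2) + ε : ℝ) := by
  obtain ⟨r, hr0, hr⟩ := hK.isBounded.exists_pos_norm_le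
  -- The three terms bound `|m - N|`, `‖ξ θ‖` and `|√m - √N| ‖ξ + θ‖`, the numerator of `v - w`; the
  -- shift `N = n - 1` turns `|A|` into `|A| + 1`.
  set D : ℝ := (|A| + 1) + r ^ 2 + 2 * r * (|A| + 1) with hD
  have hD0 : 0 ≤ D := by positivity
  set R : ℝ := 2 * r + D with hR
  have hR0 : 0 ≤ R := by positivity
  obtain ⟨C₁, hC₁, h1⟩ := exists_norm_expPartialSum_rescaled_sub_gaussErf_le hR0
  refine ⟨Real.exp (r ^ 2) * (2 * (C₁ + Real.exp (R ^ 2) * D)) + 1, by positivity,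
    -- The first summand makes `√N ≥ 2R + R³`; the second makes `N ≥ 1` and `m ≤ 4N`.
    (2 * R + R ^ 3) ^ 2 + 2 * (|A| + 2), by positivity, ?_⟩
  intro m n hm hn hnm ξ hξ η hη
  obtain ⟨N, rfl⟩ : ∃ N, n = N + 1 := ⟨n - 1, by omega⟩
  rw [Nat.add_sub_cancel]
  have hA := le_abs_self A
  have hA0 := abs_nonneg A
  have hNm : |m - N| ≤ |A| + 1 := by
    rw [abs_le] at hnm ⊢
    push_cast at hnm
    constructor <;> linarith
  have hNm' := abs_le.mp hNm
  have hsqR : 0 ≤ (2 * R + R ^ 3) ^ 2 := sq_nonneg _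
  have hN1 : (1 : ℝ) ≤ N := by linarith
  have hN0 : N ≠ 0 := by
    rintro rfl
    norm_num at hN1
  have hm1 : 1 ≤ m := by linarith
  have hNR : 2 * R + R ^ 3 ≤ √N := Real.le_sqrt_of_sq_le (by linarith)
  have hs1 : 1 ≤ √(N : ℝ) := Real.one_le_sqrt.mpr hN1
  have hs0 : 0 < √(N : ℝ) := by linarith
  have hm4 : m ≤ 2 * 2 * N := by linarith
  have hsm : √m ≤ 2 * √N := by
    refine (Real.sqrt_le_sqrt hm4).trans_eq ?_
    rw [Real.sqrt_mul (by norm_num), Real.sqrt_mul_self (by norm_num)]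
  have hsm0 : 0 < √m := Real.sqrt_pos.mpr (by linarith)
  set θ := (starRingEnd ℂ) η with hθ
  have hξr : ‖ξ‖ ≤ r := hr ξ hξ
  have hθr : ‖θ‖ ≤ r := by rw [hθ, RCLike.norm_conj]; exact hr η hη
  set w := ξ + θ with hw
  have hwr : ‖w‖ ≤ 2 * r := (norm_add_le _ _).trans (by linarith)
  have hpr : ‖ξ * θ‖ ≤ r ^ 2 := by
    rw [norm_mul, pow_two]; gcongr
  set v : ℂ := (m + (√m : ℝ) * w + ξ * θ - N) / (√N : ℝ) with hv
  have hsc : ((√N : ℝ) : ℂ) ≠ 0 := by exact_mod_cast hs0.ne'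
  have hNv : (N : ℂ) + (√N : ℝ) * v = m + (√m : ℝ) * w + ξ * θ := by
    rw [hv]; field_simp; ring
  have hvw : ‖v - w‖ ≤ D / √N := by
    have e : v - w = (((m - N : ℝ) : ℂ) + ξ * θ + ((√m - √N : ℝ) : ℂ) * w) / (√N : ℝ) := by
      rw [hv]; push_cast; field_simp; ring
    rw [e, norm_div, Complex.norm_of_nonneg hs0.le]
    gcongr
    refine (norm_add₃_le).trans ?_
    rw [norm_mul (((√m - √N : ℝ)) : ℂ), Complex.norm_real, Complex.norm_real, Real.norm_eq_abs,
      Real.norm_eq_abs]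
    have h2 : |√m - √N| ≤ |A| + 1 :=
      (abs_sqrt_sub_sqrt_le (by linarith) hN1).trans hNm
    have h3 : |√m - √N| * ‖w‖ ≤ (|A| + 1) * (2 * r) := by gcongr
    rw [hD]
    linarith
  have hvR : ‖v‖ ≤ R := by
    have h2 := norm_le_norm_add_norm_sub' v w
    have h3 : D / √N ≤ D := div_le_self hD0 hs1
    linarith
  have hwR : ‖w‖ ≤ R := by linarith
  have hpow : m ^ (-(1 / 2) : ℝ) = (√m)⁻¹ := by
    rw [Real.rpow_neg (by linarith), Real.sqrt_eq_rpow]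
  have hz : (m : ℂ) * (1 + ((m ^ (-(1 / 2) : ℝ) : ℝ) : ℂ) * ξ) *
      (1 + ((m ^ (-(1 / 2) : ℝ) : ℝ) : ℂ) * θ) = N + (√N : ℝ) * v := by
    have hmc : ((√m : ℝ) : ℂ) ≠ 0 := by exact_mod_cast hsm0.ne'
    have hmm : (m : ℂ) = ((√m : ℝ) : ℂ) * ((√m : ℝ) : ℂ) := by
      rw [← Complex.ofReal_mul, Real.mul_self_sqrt (by linarith)]
    have hi : ((√m : ℝ) : ℂ) * ((√m : ℝ) : ℂ)⁻¹ = 1 := mul_inv_cancel₀ hmc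
    rw [hNv, hpow, hw, Complex.ofReal_inv, hmm]
    -- What remains is a polynomial identity modulo `x * y = 1`.
    generalize ((√m : ℝ) : ℂ)⁻¹ = y at hi
    generalize ((√m : ℝ) : ℂ) = x at hi
    linear_combination (x * (ξ + θ) + (x * y + 1) * ξ * θ) * hi
  rw [hz]
  have hexp : ∀ E : ℂ, E / Complex.exp ((m : ℂ) + (Real.sqrt m : ℂ) * w) =
      Complex.exp (ξ * θ) * (E * Complex.exp (-(N + (√N : ℝ) * v))) := by
    intro E
    rw [div_eq_mul_inv, ← Complex.exp_neg, mul_left_comm, ← Complex.exp_add, hNv]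
    ring_nf
  have hneg : -ξ - θ = -w := by rw [hw]; ring
  rw [hexp, hneg, ← mul_sub, norm_mul]
  have hmain : ‖expPartialSum N (N + (√N : ℝ) * v) * Complex.exp (-(N + (√N : ℝ) * v)) -
      gaussErf (-w)‖ ≤ (C₁ + Real.exp (R ^ 2) * D) / √N := by
    have h2 := h1 N hN0 hNR v hvR
    have h3 : ‖gaussErf (-v) - gaussErf (-w)‖ ≤ Real.exp (R ^ 2) * (D / √N) := by
      refine (norm_gaussErf_sub_le (R := R) ((norm_neg w).trans_le hwR)
        ((norm_neg v).trans_le hvR)).trans ?_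
      rw [neg_sub_neg, norm_sub_rev]
      gcongr
    refine (norm_sub_le_norm_sub_add_norm_sub _ (gaussErf (-v)) _).trans ?_
    rw [add_div, mul_div_assoc]
    exact add_le_add h2 h3
  -- The error is already `O(m ^ (-1/2))`; `ε` enters only here, through `m ≥ 1`.
  have hsN : (√(N : ℝ))⁻¹ ≤ 2 * m ^ (-(1 / 2) + ε : ℝ) := by
    have h2 : m ^ (-(1 / 2) : ℝ) ≤ m ^ (-(1 / 2) + ε : ℝ) :=
      Real.rpow_le_rpow_of_exponent_le hm1 (by linarith)
    rw [hpow] at h2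
    have h3 : (√(N : ℝ))⁻¹ ≤ 2 * (√m)⁻¹ := by
      rw [← div_eq_mul_inv, le_div_iff₀ hsm0, inv_mul_le_iff₀ hs0]
      linarith
    linarith
  have hexpr : ‖Complex.exp (ξ * θ)‖ ≤ Real.exp (r ^ 2) :=
    (Complex.norm_exp_le_exp_norm _).trans (Real.exp_le_exp.mpr hpr)
  have hmpos : 0 ≤ m ^ (-(1 / 2) + ε : ℝ) := Real.rpow_nonneg (by linarith) _
  calc _ ≤ Real.exp (r ^ 2) * ((C₁ + Real.exp (R ^ 2) * D) * (√(N : ℝ))⁻¹) := by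
        rw [← div_eq_mul_inv]; gcongr
    _ ≤ Real.exp (r ^ 2) * ((C₁ + Real.exp (R ^ 2) * D) * (2 * m ^ (-(1 / 2) + ε : ℝ))) := by
        gcongr
    _ ≤ _ := by linarith
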